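/- Let $K$ be a field. For a finite simple graph $G$ on the vertex set $V$ with edge set $E(G)$, and for an unordered partition $A|B$ of $V$ (that is, $A\cap B=\emptyset$, $A\cup B=V$, $A|B=B|A$, with $\emptyset|V$ allowed), put $$u_{A|B}=s\cdot\prod_{\substack{ij\in E(G)\\ |A\cap\{i,j\}|=1}}t_{ij}\in K[s,t_{ij}\mid ij\in E(G)].$$ The toric ring $R_G$ of the cut ideal of $G$ is the $K$-subalgebra of $K[s,t_{ij}\mid ij\in E(G)]$ generated by all $u_{A|B}$, that is, the image of the homomorphism $K[q_{A|B}]\to K[s,t_{ij}]$, $q_{A|B}\mapsto u_{A|B}$; it is graded by $\deg u_{A|B}=1$. The ring $R_G$ is called strongly Koszul if for all $A|B\neq C|D$ the ideal $(u_{A|B})\cap(u_{C|D})$ of $R_G$ is generated by elements of degree $2$. Let $K_{l_1,\dots,l_m}$ denote the complete $m$-partite graph with parts of sizes $l_1,\dots,l_m$. Let $n\ge 4$. Then $R_{K_{1,1,n-2}}$ and $R_{K_{2,n-2}}$ are strongly Koszul. Moreover, there is an isomorphism of $K$-algebras $R_{K_{1,1,n-2}}\cong R_{K_{1,n-2}}\otimes_K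 R_{K_{1,n-2}}$ that maps the set of generators $u_{A|B}$ of $R_{K_{1,1,n-2}}$ onto the set of all $u\otimes 1$ and $1\otimes u$, where $u$ runs through the generators $u_{C|D}$ of $R_{K_{1,n-2}}$. -/

import Mathlib

open scoped TensorProduct

noncomputable section

namespace CutToric

/-- The complete multipartite graph `K_{l 0, ..., l (m-1)}`: its parts are disjoint copies of
`Fin (l i)`, and two vertices are adjacent iff they lie in different parts. -/
abbrev completeMultipartite {m : ℕ} (l : Fin m → ℕ) : SimpleGraph (Σ i : Fin m, Fin (l i)) :=
  SimpleGraph.completeMultipartiteGraph fun i => Fin (l i)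

/-- `A` and `B` define the same unordered partition of `V` into two sets: `A = B` or `A = Bᶜ`. -/
def cutSetoid (V : Type*) : Setoid (Set V) where
  r A B := A = B ∨ A = Bᶜ
  iseqv :=
    { refl := fun _ => Or.inl rfl
      symm := by
        rintro A B (rfl | rfl)
        · exact Or.inl rfl
        · exact Or.inr (compl_compl B).symm
      trans := by
        rintro A B C (rfl | rfl) (rfl | rfl)
        · exact Or.inl rfl
        · exact Or.inr rfl
        · exact Or.inr rfl
        · exact Or.inl (compl_compl C) }

/-- The unordered partitions `A | B` of `V` (so `A ∩ B = ∅`, `A ∪ B = V`, and `A | B = B | A`;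
the partition `∅ | V` is included). The class of `A : Set V` is `A | Aᶜ`. -/
def Cut (V : Type*) : Type _ := Quotient (cutSetoid V)

/-- The pair `e` has exactly one of its two endpoints in `A`. -/
def Separates {V : Type*} (A : Set V) (e : Sym2 V) : Prop :=
  ∃ i ∈ A, ∃ j ∉ A, e = s(i, j)

theorem separates_compl {V : Type*} (A : Set V) (e : Sym2 V) :
    Separates Aᶜ e ↔ Separates A e := by
  constructor
  · rintro ⟨i, hi, j, hj, rfl⟩
    exact ⟨j, not_not.mp hj, i, hi, Sym2.eq_swap⟩
  · rintro ⟨i, hi, j, hj, rfl⟩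
    exact ⟨j, hj, i, not_not.mpr hi, Sym2.eq_swap⟩

section

variable (K : Type*) [Field K] {V : Type*} [Fintype V] (G : SimpleGraph V)

open Classical in
/-- The monomial `s * ∏ t_e`, the product over the edges `e` of `G` separated by `A`, in the
polynomial ring `K[s, t_e | e ∈ E(G)]`; here `s = X none` and `t_e = X (some e)`. -/
def setMonomial (A : Set V) : MvPolynomial (Option G.edgeSet) K :=
  MvPolynomial.X none *
    ∏ e : G.edgeSet, if Separates A (e : Sym2 V) then MvPolynomial.X (some e) else 1

theorem setMonomial_compl (A : Set V) : setMonomial K G Aᶜ = setMonomial K G A := by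
  unfold setMonomial
  congr 1
  refine Finset.prod_congr rfl fun e _ => ?_
  by_cases h : Separates A (e : Sym2 V)
  · rw [if_pos h, if_pos ((separates_compl A _).mpr h)]
  · rw [if_neg h, if_neg fun h' => h ((separates_compl A _).mp h')]

/-- The monomial of an unordered partition `A | B`. -/
def cutMonomial (c : Cut V) : MvPolynomial (Option G.edgeSet) K :=
  Quotient.lift (setMonomial K G)
    (by
      rintro A B (rfl | rfl)
      · rfl
      · exact setMonomial_compl K G B) c

/-- The homomorphism `π_G : K[q] → K[s, T]`, one variable `q_c` for each cut `c`; its kernel is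
the cut ideal of `G`. -/
def cutHom : MvPolynomial (Cut V) K →ₐ[K] MvPolynomial (Option G.edgeSet) K :=
  MvPolynomial.aeval (cutMonomial K G)

/-- The toric ring `R_G` of the cut ideal: the image of `π_G`. -/
abbrev cutRing : Subalgebra K (MvPolynomial (Option G.edgeSet) K) := (cutHom K G).range

/-- The generator `u_c = π_G(q_c)` of `R_G`. -/
def cutGen (c : Cut V) : cutRing K G := (cutHom K G).rangeRestrict (MvPolynomial.X c)

end

section

variable (K : Type*) [Field K] {R : Type*} [CommRing R] [Algebra K R] {ι : Type*}

/-- The degree `d` part of the `K`-algebra `R` generated by the elements `u i` of degree one: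
the `K`-span of the products of `d` generators. -/
def degreePart (u : ι → R) (d : ℕ) : Submodule K R := Submodule.span K (Set.range u) ^ d

/-- The ideal `I` is generated by elements of degree `d`. -/
def IsGeneratedInDegree (u : ι → R) (d : ℕ) (I : Ideal R) : Prop :=
  ∃ S : Set R, S ⊆ degreePart K u d ∧ I = Ideal.span S

/-- Strong Koszulness of the semigroup ring `R` with generators `u i`:
the ideals `(u i) ∩ (u j)`, `i ≠ j`, are generated in degree two. -/
def IsStronglyKoszul (u : ι → R) : Prop :=
  ∀ i j : ι, i ≠ j → IsGeneratedInDegree K u 2 (Ideal.span {u i} ⊓ Ideal.span {u j})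

end

end CutToric

end

noncomputable section

namespace CutToric

/-! Put m = n - 2. A cut of the star K_{1,m}, normalised to carry the bit `false` at the centre, is
a bit vector x on the leaves, and its monomial is s times the t_i with x_i true. With s as
homogenising variable these generate the Segre product of m polynomial rings in two variables, whose
exponent monoid is `segre`.

In K_{1,1,m} a cut has one more bit, at the second singleton part. It splits the generators into two
families, each a copy of the Segre generators, and the edge joining the singletons counts the second
family. The exponent map on `segre × segre` is injective (`exists_triExponentHom`), so the ring is
the algebra of a product monoid, that is, the tensor square. In K_{2,m} that edge is missing. The
only new coincidence is that x + x̄ gives s² ∏ t_e, over all edges, in both families; the fibres of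
the exponent map are the classes of `PairRel` (`exists_biExponentHom`).

Since the ideals are monomial, strong Koszulness becomes an exchange property
(`isStronglyKoszul_cutGen`): a monomial divisible in the ring by u_i and u_j is divisible by some
u_i u_p = u_j u_q. In `segre` this is solved one coordinate at a time (`segre_exchange`). For
generators from different families u_i u_j itself serves, except that modulo `PairRel` one may have
to trade x + x̄ for y + ȳ (`pairRel_exchange_mixed`). -/

/-- The cut `A | Aᶜ`. -/
def Cut.mk {V : Type*} (A : Set V) : Cut V := Quotient.mk (cutSetoid V) A

theorem Cut.mk_compl {V : Type*} (A : Set V) : Cut.mk Aᶜ = Cut.mk A :=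
  Quotient.sound (Or.inr rfl)

/-! ### Exponent vectors of cut monomials. -/

section Exponent

variable {V : Type*} [Fintype V] (G : SimpleGraph V)

open Classical in
/-- The exponent vector of the monomial of the cut `A | Aᶜ`. -/
def cutExponent (A : Set V) : Option G.edgeSet →₀ ℕ :=
  Finsupp.equivFunOnFinite.symm fun o =>
    o.elim 1 fun e => if Separates A (e : Sym2 V) then 1 else 0

open Classical in
theorem setMonomial_eq_monomial (K : Type*) [Field K] (A : Set V) :
    setMonomial K G A = MvPolynomial.monomial (cutExponent G A) 1 := by
  rw [MvPolynomial.monomial_eq, Finsupp.prod_fintype _ _ (by simp), Fintype.prod_option]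
  simp [setMonomial, cutExponent]

theorem cutGen_mk_coe (K : Type*) [Field K] (A : Set V) :
    (cutGen K G (Cut.mk A) : MvPolynomial (Option G.edgeSet) K) =
      MvPolynomial.monomial (cutExponent G A) 1 := by
  rw [← setMonomial_eq_monomial]
  exact MvPolynomial.aeval_X _ _

open Classical in
/-- An additive map to exponent vectors is obtained from its values edge by edge. -/
theorem exists_exponentHom {ι Q : Type*} [AddCommMonoid Q] (g : ι → Q) (A : ι → Set V)
    (deg : Q →+ ℕ) (hdeg : ∀ i, deg (g i) = 1)
    (hF : ∀ e ∈ G.edgeSet, ∃ f : Q →+ ℕ, ∀ i, f (g i) = if Separates (A i) e then 1 else 0) :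
    ∃ ℓ : Q →+ (Option G.edgeSet →₀ ℕ), ∀ i, ℓ (g i) = cutExponent G (A i) := by
  choose! f hf using hF
  refine ⟨{ toFun := fun q => Finsupp.equivFunOnFinite.symm fun o =>
              o.elim (deg q) fun e => f e q
            map_zero' := ?_
            map_add' := ?_ }, ?_⟩
  · ext o; cases o <;> simp
  · intro p q; ext o; cases o <;> simp
  · intro i
    ext o
    cases o with
    | none => simp [cutExponent, hdeg]
    | some e => simp [cutExponent, hf e.1 e.2]

-- Both sides are additive and agree on generators. This makes the coordinates of `ℓ`, known only
-- through its values on generators, computable everywhere.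
open Classical in
theorem exponentHom_apply_some {ι Q : Type*} [AddCommMonoid Q] {g : ι → Q}
    (hgen : AddSubmonoid.closure (Set.range g) = ⊤) {A : ι → Set V}
    {ℓ : Q →+ (Option G.edgeSet →₀ ℕ)} (hℓ : ∀ i, ℓ (g i) = cutExponent G (A i))
    (e : G.edgeSet) (f : Q →+ ℕ)
    (hf : ∀ i, f (g i) = if Separates (A i) (e : Sym2 V) then 1 else 0) (q : Q) :
    ℓ q (some e) = f q := by
  have : (Finsupp.applyAddHom (some e)).comp ℓ = f := by
    refine AddMonoidHom.eq_of_eqOn_denseM hgen ?_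
    rintro _ ⟨i, rfl⟩
    simp [hℓ, hf, cutExponent]
  exact DFunLike.congr_fun this q

theorem exponentHom_apply_none {ι Q : Type*} [AddCommMonoid Q] {g : ι → Q}
    (hgen : AddSubmonoid.closure (Set.range g) = ⊤) {A : ι → Set V}
    {ℓ : Q →+ (Option G.edgeSet →₀ ℕ)} (hℓ : ∀ i, ℓ (g i) = cutExponent G (A i))
    (f : Q →+ ℕ) (hf : ∀ i, f (g i) = 1) (q : Q) :
    ℓ q none = f q := by
  have : (Finsupp.applyAddHom none).comp ℓ = f := by
    refine AddMonoidHom.eq_of_eqOn_denseM hgen ?_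
    rintro _ ⟨i, rfl⟩
    simp [hℓ, hf, cutExponent]
  exact DFunLike.congr_fun this q

end Exponent

/-! ### Monoid algebras and monomial maps. -/

section Toric

variable (K : Type*) [Field K] {σ Q : Type*} [AddCommMonoid Q]

/-- The monomial map `K[Q] → K[σ]` attached to an additive map to exponent vectors. -/
def toricHom (ℓ : Q →+ (σ →₀ ℕ)) : AddMonoidAlgebra K Q →ₐ[K] MvPolynomial σ K :=
  AddMonoidAlgebra.mapDomainAlgHom K K ℓ

theorem toricHom_single (ℓ : Q →+ (σ →₀ ℕ)) (q : Q) (r : K) :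
    toricHom K ℓ (AddMonoidAlgebra.single q r) = MvPolynomial.monomial (ℓ q) r :=
  AddMonoidAlgebra.mapDomain_single

theorem toricHom_injective {ℓ : Q →+ (σ →₀ ℕ)} (hℓ : Function.Injective ℓ) :
    Function.Injective (toricHom K ℓ) :=
  AddMonoidAlgebra.mapDomain_injective hℓ

theorem exists_of_mem_support_toricHom (ℓ : Q →+ (σ →₀ ℕ)) (x : AddMonoidAlgebra K Q)
    {e : σ →₀ ℕ} (he : e ∈ (toricHom K ℓ x).support) : ∃ q, e = ℓ q := by
  induction x using AddMonoidAlgebra.induction_linear with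
  | zero => simp at he
  | add x y hx hy =>
    rw [map_add] at he
    classical
    rcases Finset.mem_union.mp (MvPolynomial.support_add he) with h | h
    exacts [hx h, hy h]
  | single q r =>
    rw [toricHom_single] at he
    exact ⟨q, by simpa using MvPolynomial.support_monomial_subset he⟩

theorem adjoin_single_eq_top {ι : Type*} {g : ι → Q}
    (hgen : AddSubmonoid.closure (Set.range g) = ⊤) :
    Algebra.adjoin K (Set.range fun i => (AddMonoidAlgebra.single (g i) 1 : AddMonoidAlgebra K Q))
      = ⊤ := by
  rw [eq_top_iff]
  rintro x -
  have key : ∀ q : Q, (AddMonoidAlgebra.single q 1 : AddMonoidAlgebra K Q) ∈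
      Algebra.adjoin K
        (Set.range fun i => (AddMonoidAlgebra.single (g i) 1 : AddMonoidAlgebra K Q)) := by
    intro q
    have hq : q ∈ AddSubmonoid.closure (Set.range g) := hgen ▸ AddSubmonoid.mem_top q
    induction hq using AddSubmonoid.closure_induction with
    | mem q hq =>
      obtain ⟨i, rfl⟩ := hq
      exact Algebra.subset_adjoin ⟨i, rfl⟩
    | zero => exact one_mem _
    | add p q _ _ hp hq => simpa [AddMonoidAlgebra.single_mul_single] using mul_mem hp hq
  induction x using AddMonoidAlgebra.induction_linear with
  | zero => exact zero_mem _
  | add x y hx hy => exact add_mem hx hy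
  | single q r => simpa using Subalgebra.smul_mem _ (key q) r

/-- The tensor product of two monoid algebras is the algebra of the product monoid. -/
def prodTensorEquiv (P : Type*) [AddCommMonoid P] :
    AddMonoidAlgebra K Q ⊗[K] AddMonoidAlgebra K P ≃ₐ[K] AddMonoidAlgebra K (Q × P) :=
  Algebra.TensorProduct.algEquivOfLinearEquivTensorProduct (AddMonoidAlgebra.tensorEquiv K)
    (by
      intro a₁ a₂ b₁ b₂
      induction a₁ using AddMonoidAlgebra.induction_linear with
      | zero => simp
      | add x y hx hy => simp only [add_mul, TensorProduct.add_tmul, map_add, hx, hy]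
      | single q r =>
      induction a₂ using AddMonoidAlgebra.induction_linear with
      | zero => simp
      | add x y hx hy => simp only [mul_add, TensorProduct.add_tmul, map_add, hx, hy]
      | single q' r' =>
      induction b₁ using AddMonoidAlgebra.induction_linear with
      | zero => simp
      | add x y hx hy => simp only [add_mul, TensorProduct.tmul_add, map_add, hx, hy]
      | single p s =>
      induction b₂ using AddMonoidAlgebra.induction_linear with
      | zero => simp
      | add x y hx hy => simp only [mul_add, TensorProduct.tmul_add, map_add, hx, hy]
      | single p' s' =>
      simp only [AddMonoidAlgebra.single_mul_single, AddMonoidAlgebra.tensorEquiv_single_tmul_single,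
        Prod.mk_add_mk]
      congr 1
      ring)
    (by
      simp only [AddMonoidAlgebra.one_def, AddMonoidAlgebra.tensorEquiv_single_tmul_single, mul_one]
      rfl)

theorem prodTensorEquiv_symm_single {P : Type*} [AddCommMonoid P] (q : Q) (p : P) :
    (prodTensorEquiv K P).symm (AddMonoidAlgebra.single (q, p) 1) =
      AddMonoidAlgebra.single q 1 ⊗ₜ[K] AddMonoidAlgebra.single p 1 := by
  rw [AlgEquiv.symm_apply_eq]
  simp [prodTensorEquiv]

end Toric

/-! ### Cut rings as images of monoid algebras; the criterion for strong Koszulness. -/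

section CutRing

variable (K : Type*) [Field K] {V : Type*} [Fintype V] {G : SimpleGraph V}
  {ι Q : Type*} [AddCommMonoid Q] {g : ι → Q} {A : ι → Set V}
  {ℓ : Q →+ (Option G.edgeSet →₀ ℕ)}

theorem range_toricHom_eq_cutRing (hgen : AddSubmonoid.closure (Set.range g) = ⊤)
    (hA : Function.Surjective fun i => Cut.mk (A i))
    (hℓ : ∀ i, ℓ (g i) = cutExponent G (A i)) :
    (toricHom K ℓ).range = cutRing K G := by
  rw [← Algebra.map_top, ← adjoin_single_eq_top K hgen, AlgHom.map_adjoin, cutRing, cutHom,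
    ← Algebra.adjoin_range_eq_range_aeval, ← hA.range_comp, ← Set.range_comp]
  congr 2
  ext i : 1
  simp only [Function.comp_apply, toricHom_single, hℓ]
  rw [← setMonomial_eq_monomial]
  rfl

/-- If the exponent map is injective, the toric ring is the monoid algebra. -/
def toricEquiv (hinj : Function.Injective ℓ) (h : (toricHom K ℓ).range = cutRing K G) :
    AddMonoidAlgebra K Q ≃ₐ[K] cutRing K G :=
  (AlgEquiv.ofInjective (toricHom K ℓ) (toricHom_injective K hinj)).trans
    (Subalgebra.equivOfEq _ _ h)

theorem toricEquiv_single (hinj : Function.Injective ℓ)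
    (h : (toricHom K ℓ).range = cutRing K G) (hℓ : ∀ i, ℓ (g i) = cutExponent G (A i)) (i : ι) :
    toricEquiv K hinj h (AddMonoidAlgebra.single (g i) 1) = cutGen K G (Cut.mk (A i)) := by
  apply Subtype.ext
  rw [cutGen_mk_coe, ← hℓ, ← toricHom_single]
  rfl

/-- Strong Koszulness of the toric ring, read off from the monoid `Q`. -/
theorem isStronglyKoszul_cutGen (hgen : AddSubmonoid.closure (Set.range g) = ⊤)
    (hA : Function.Surjective fun i => Cut.mk (A i))
    (hℓ : ∀ i, ℓ (g i) = cutExponent G (A i))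
    -- Equalities are required only after applying `ℓ`, so that a non-injective exponent map is
    -- allowed.
    (hQ : ∀ i j, i ≠ j → ∀ a b, ℓ (g i + a) = ℓ (g j + b) → ∃ p q c,
      ℓ (g i + g p) = ℓ (g j + g q) ∧ ℓ (g i + a) = ℓ (g i + g p + c)) :
    IsStronglyKoszul K (cutGen K G) := by
  have hR := range_toricHom_eq_cutRing K hgen hA hℓ
  have hu : ∀ i, (cutGen K G (Cut.mk (A i)) : MvPolynomial (Option G.edgeSet) K) =
      MvPolynomial.monomial (ℓ (g i)) 1 := fun i => by rw [cutGen_mk_coe, hℓ]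
  have hsupp : ∀ (i : ι) (x : cutRing K G) (e : Option G.edgeSet →₀ ℕ),
      e ∈ (cutGen K G (Cut.mk (A i)) * x : MvPolynomial (Option G.edgeSet) K).support →
      ∃ q, e = ℓ (g i + q) := by
    intro i x e he
    rw [MvPolynomial.mem_support_iff, hu, MvPolynomial.coeff_monomial_mul'] at he
    split_ifs at he with hle
    · obtain ⟨y, hy⟩ : (x : MvPolynomial (Option G.edgeSet) K) ∈ (toricHom K ℓ).range := by
        rw [hR]; exact x.2
      rw [one_mul, ← MvPolynomial.mem_support_iff, ← hy] at he
      obtain ⟨q, hq⟩ := exists_of_mem_support_toricHom K ℓ y he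
      exact ⟨q, by rw [map_add, ← hq, add_tsub_cancel_of_le hle]⟩
    · exact absurd rfl he
  intro c d hcd
  obtain ⟨i, rfl⟩ := hA c
  obtain ⟨j, rfl⟩ := hA d
  have hij : i ≠ j := fun h => hcd (by rw [h])
  refine ⟨{x | ∃ p q, x = cutGen K G (Cut.mk (A i)) * cutGen K G (Cut.mk (A p)) ∧
    ℓ (g i + g p) = ℓ (g j + g q)}, ?_, le_antisymm ?_ ?_⟩
  · rintro _ ⟨p, q, rfl, -⟩
    rw [SetLike.mem_coe, degreePart, pow_two]
    exact Submodule.mul_mem_mul (Submodule.subset_span ⟨_, rfl⟩) (Submodule.subset_span ⟨_, rfl⟩)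
  · rintro f ⟨hfi, hfj⟩
    obtain ⟨a, ha⟩ := Ideal.mem_span_singleton'.mp hfi
    obtain ⟨b, hb⟩ := Ideal.mem_span_singleton'.mp hfj
    rw [mul_comm] at ha hb
    -- Each single term of `f` is already a multiple of a quadratic generator, and the cofactor lies
    -- in the ring because its exponent is in the image of `ℓ`.
    have hterm : ∀ e ∈ (f : MvPolynomial (Option G.edgeSet) K).support,
        ∃ h ∈ Ideal.span {x | ∃ p q, x = cutGen K G (Cut.mk (A i)) * cutGen K G (Cut.mk (A p)) ∧
          ℓ (g i + g p) = ℓ (g j + g q)},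
        (h : MvPolynomial (Option G.edgeSet) K) =
          MvPolynomial.monomial e (MvPolynomial.coeff e f) := by
      intro e he
      obtain ⟨a', ha'⟩ := hsupp i a e (by rw [← MulMemClass.coe_mul, ha]; exact he)
      obtain ⟨b', hb'⟩ := hsupp j b e (by rw [← MulMemClass.coe_mul, hb]; exact he)
      obtain ⟨p, q, c, hpq, hc⟩ := hQ i j hij a' b' (ha'.symm.trans hb')
      have hmem : MvPolynomial.monomial (ℓ c) (MvPolynomial.coeff e
          (f : MvPolynomial (Option G.edgeSet) K)) ∈ cutRing K G :=
        hR.le ⟨_, toricHom_single K ℓ c _⟩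
      refine ⟨cutGen K G (Cut.mk (A i)) * cutGen K G (Cut.mk (A p)) * ⟨_, hmem⟩,
        Ideal.mul_mem_right _ _ (Ideal.subset_span ⟨p, q, rfl, hpq⟩), ?_⟩
      rw [MulMemClass.coe_mul, MulMemClass.coe_mul, hu, hu, MvPolynomial.monomial_mul,
        MvPolynomial.monomial_mul, ← map_add, ← map_add, ← hc, ← ha', one_mul, one_mul]
    choose! h hmem hh using hterm
    have : f = ∑ e ∈ (f : MvPolynomial (Option G.edgeSet) K).support, h e := by
      apply Subtype.ext
      rw [AddSubmonoidClass.coe_finsetSum, Finset.sum_congr rfl hh]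
      exact (MvPolynomial.support_sum_monomial_coeff _).symm
    rw [this]
    exact Ideal.sum_mem _ hmem
  · rw [Ideal.span_le]
    rintro _ ⟨p, q, rfl, hpq⟩
    refine ⟨Ideal.mul_mem_right _ _ (Ideal.mem_span_singleton_self _), ?_⟩
    have : cutGen K G (Cut.mk (A i)) * cutGen K G (Cut.mk (A p)) =
        cutGen K G (Cut.mk (A j)) * cutGen K G (Cut.mk (A q)) := by
      apply Subtype.ext
      simp only [MulMemClass.coe_mul, hu, MvPolynomial.monomial_mul, ← map_add, hpq]
    rw [this]
    exact Ideal.mul_mem_right _ _ (Ideal.mem_span_singleton_self _)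

end CutRing

/-! ### The Segre monoid and its exchange property. -/

section Segre

variable {I : Type*}

/-- The exponent monoid of the Segre product of polynomial rings in two variables, one for each
`i : I`: the degree together with two exponents summing to it for each `i`. -/
def segre (I : Type*) : AddSubmonoid (ℕ × (I → ℕ) × (I → ℕ)) where
  carrier := {q | ∀ i, q.2.1 i + q.2.2 i = q.1}
  zero_mem' := fun i => rfl
  add_mem' := by
    intro p q hp hq i
    have := hp i
    have := hq i
    simp only [Prod.fst_add, Prod.snd_add, Pi.add_apply]
    omega

/-- The degree. -/
def segDeg : segre I →+ ℕ := (AddMonoidHom.fst _ _).comp (segre I).subtype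

/-- The exponent of the first variable of the factor `i`. -/
def segOne (i : I) : segre I →+ ℕ :=
  (Pi.evalAddMonoidHom _ i).comp
    ((AddMonoidHom.fst _ _).comp ((AddMonoidHom.snd _ _).comp (segre I).subtype))

/-- The exponent of the second variable of the factor `i`. -/
def segZero (i : I) : segre I →+ ℕ :=
  (Pi.evalAddMonoidHom _ i).comp
    ((AddMonoidHom.snd _ _).comp ((AddMonoidHom.snd _ _).comp (segre I).subtype))

theorem segOne_add_segZero (i : I) (q : segre I) : segOne i q + segZero i q = segDeg q := q.2 i

theorem segre_ext {p q : segre I} (hd : segDeg p = segDeg q)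
    (h : ∀ i, segOne i p = segOne i q) : p = q := by
  refine Subtype.ext (Prod.ext hd (Prod.ext (funext h) (funext fun i => ?_)))
  have h₁ := segOne_add_segZero i p
  have h₂ := segOne_add_segZero i q
  have h₃ := h i
  change segZero i p = segZero i q
  omega

/-- The generator of `segre I` given by a choice of a variable in each factor. -/
def segGen (x : I → Bool) : segre I :=
  ⟨(1, fun i => if x i then 1 else 0, fun i => if x i then 0 else 1), fun i => by
    cases h : x i <;> simp [h]⟩

@[simp] theorem segDeg_segGen (x : I → Bool) : segDeg (segGen x) = 1 := rfl

@[simp] theorem segOne_segGen (i : I) (x : I → Bool) :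
    segOne i (segGen x) = if x i then 1 else 0 := rfl

@[simp] theorem segZero_segGen (i : I) (x : I → Bool) :
    segZero i (segGen x) = if x i then 0 else 1 := rfl

/-- The element `x + x̄` of degree two, the same for all generators `x`. -/
def segPair (I : Type*) : segre I := ⟨(2, 1, 1), fun _ => rfl⟩

@[simp] theorem segDeg_segPair : segDeg (segPair I) = 2 := rfl

@[simp] theorem segOne_segPair (i : I) : segOne i (segPair I) = 1 := rfl

@[simp] theorem segZero_segPair (i : I) : segZero i (segPair I) = 1 := rfl

theorem segGen_add_segGen_not (x : I → Bool) :
    segGen x + segGen (fun i => !x i) = segPair I := by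
  refine segre_ext (by simp) fun i => ?_
  cases h : x i <;> simp [h]

theorem exists_eq_segGen_add {q : segre I} {x : I → Bool} (hd : 1 ≤ segDeg q)
    (h₁ : ∀ i, x i = true → 1 ≤ segOne i q) (h₀ : ∀ i, x i = false → 1 ≤ segZero i q) :
    ∃ a, q = segGen x + a := by
  refine ⟨⟨(segDeg q - 1, fun i => segOne i q - segOne i (segGen x),
    fun i => segZero i q - segZero i (segGen x)), fun i => ?_⟩, segre_ext ?_ fun i => ?_⟩
  · have := segOne_add_segZero i q
    change (segOne i q - segOne i (segGen x)) + (segZero i q - segZero i (segGen x)) =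
      segDeg q - 1
    rw [segOne_segGen, segZero_segGen]
    cases h : x i
    · have := h₀ i h
      simp only [Bool.false_eq_true, if_false]
      omega
    · have := h₁ i h
      simp only [if_true]
      omega
  · rw [map_add]
    change segDeg q = 1 + (segDeg q - 1)
    omega
  · rw [map_add]
    change segOne i q = segOne i (segGen x) + (segOne i q - segOne i (segGen x))
    have := h₁ i
    cases h : x i <;> simp_all

theorem closure_range_segGen : AddSubmonoid.closure (Set.range (segGen (I := I))) = ⊤ := by
  rw [eq_top_iff]
  rintro q -
  induction hd : segDeg q generalizing q with
  | zero =>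
    have : q = 0 := by
      refine segre_ext (by rw [hd, map_zero]) fun i => ?_
      have := segOne_add_segZero i q
      rw [map_zero]
      omega
    rw [this]
    exact zero_mem _
  | succ d ih =>
    -- Take the first variable wherever it occurs; elsewhere the second one does, since the two
    -- exponents sum to a positive degree.
    obtain ⟨a, ha⟩ : ∃ a, q = segGen (fun i => decide (1 ≤ segOne i q)) + a := by
      refine exists_eq_segGen_add (by omega) (fun i hi => by simpa using hi) fun i hi => ?_
      have := segOne_add_segZero i q
      simp only [decide_eq_false_iff_not] at hi
      omega
    rw [ha] at hd ⊢
    refine add_mem (AddSubmonoid.subset_closure ⟨_, rfl⟩) (ih ?_)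
    rw [map_add, segDeg_segGen] at hd
    omega

theorem segre_exchange {x y : I → Bool} (hxy : x ≠ y) {a b : segre I}
    (h : segGen x + a = segGen y + b) :
    ∃ z w c, segGen x + segGen z = segGen y + segGen w ∧ a = segGen z + c := by
  have hO : ∀ i, segOne i (segGen x) + segOne i a = segOne i (segGen y) + segOne i b := fun i => by
    rw [← map_add, h, map_add]
  have hZ : ∀ i, segZero i (segGen x) + segZero i a = segZero i (segGen y) + segZero i b :=
    fun i => by rw [← map_add, h, map_add]
  have hpos : 1 ≤ segDeg a := by
    -- Where x and y differ, `a` must supply the variable chosen by y.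
    obtain ⟨i, hi⟩ := Function.ne_iff.mp hxy
    rw [← segOne_add_segZero i a]
    have := hO i
    have := hZ i
    cases hx : x i <;> cases hy : y i <;> simp_all <;> omega
  -- Where x and y differ, z and w are forced to be y and x; where they agree, both take a variable
  -- occurring in `a`.
  let z : I → Bool := fun i => if x i = y i then decide (1 ≤ segOne i a) else y i
  let w : I → Bool := fun i => if x i = y i then decide (1 ≤ segOne i a) else x i
  obtain ⟨c, hc⟩ : ∃ c, a = segGen z + c := by
    refine exists_eq_segGen_add hpos (fun i hi => ?_) fun i hi => ?_
    · have := hO i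
      by_cases hxy : x i = y i
      · simpa [z, hxy] using hi
      · simp only [z, hxy, if_false] at hi
        cases hx : x i <;> simp_all
    · have := hZ i
      have := segOne_add_segZero i a
      by_cases hxy : x i = y i
      · simp only [z, hxy, if_true, decide_eq_false_iff_not] at hi
        omega
      · simp only [z, hxy, if_false] at hi
        cases hx : x i <;> simp_all
  refine ⟨z, w, c, segre_ext (by simp) fun i => ?_, hc⟩
  by_cases hxy : x i = y i
  · simp [z, w, hxy]
  · simp [z, w, hxy, add_comm]

end Segre

/-! ### Two copies of the Segre monoid, free and glued along x + x̄. -/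

section Double

variable {I : Type*}

/-- The generators of `segre I × segre I`. -/
def pairGen (p : Bool × (I → Bool)) : segre I × segre I :=
  if p.1 then (0, segGen p.2) else (segGen p.2, 0)

@[simp] theorem pairGen_false (x : I → Bool) : pairGen (false, x) = (segGen x, 0) := rfl

@[simp] theorem pairGen_true (x : I → Bool) : pairGen (true, x) = (0, segGen x) := rfl

theorem closure_range_pairGen : AddSubmonoid.closure (Set.range (pairGen (I := I))) = ⊤ := by
  rw [eq_top_iff]
  rintro ⟨a, b⟩ -
  have ha : (a, (0 : segre I)) ∈ AddSubmonoid.closure (Set.range (pairGen (I := I))) := by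
    have h : a ∈ AddSubmonoid.closure (Set.range (segGen (I := I))) :=
      closure_range_segGen (I := I) ▸ AddSubmonoid.mem_top a
    induction h using AddSubmonoid.closure_induction with
    | mem a ha =>
      obtain ⟨x, rfl⟩ := ha
      exact AddSubmonoid.subset_closure ⟨(false, x), rfl⟩
    | zero => exact zero_mem _
    | add p q _ _ hp hq => simpa using add_mem hp hq
  have hb : ((0 : segre I), b) ∈ AddSubmonoid.closure (Set.range (pairGen (I := I))) := by
    have h : b ∈ AddSubmonoid.closure (Set.range (segGen (I := I))) :=
      closure_range_segGen (I := I) ▸ AddSubmonoid.mem_top b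
    induction h using AddSubmonoid.closure_induction with
    | mem a ha =>
      obtain ⟨x, rfl⟩ := ha
      exact AddSubmonoid.subset_closure ⟨(true, x), rfl⟩
    | zero => exact zero_mem _
    | add p q _ _ hp hq => simpa using add_mem hp hq
  simpa using add_mem ha hb

theorem pairGen_exchange {i j : Bool × (I → Bool)} (hij : i ≠ j) {a b : segre I × segre I}
    (h : pairGen i + a = pairGen j + b) :
    ∃ p q c, pairGen i + pairGen p = pairGen j + pairGen q ∧
      pairGen i + a = pairGen i + pairGen p + c := by
  obtain ⟨β, x⟩ := i
  obtain ⟨γ, y⟩ := j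
  obtain ⟨a₀, a₁⟩ := a
  obtain ⟨b₀, b₁⟩ := b
  cases β <;> cases γ <;>
    simp only [pairGen_false, pairGen_true, Prod.mk_add_mk, Prod.mk.injEq, zero_add] at h
  · obtain ⟨z, w, c, hzw, hc⟩ := segre_exchange (fun e => hij (by rw [e])) h.1
    exact ⟨(false, z), (false, w), (c, a₁), by simp [hzw], by simp [hc, add_assoc]⟩
  · exact ⟨(true, y), (false, x), (a₀, b₁), by simp, by simp [h.2]⟩
  · exact ⟨(false, y), (true, x), (b₀, a₁), by simp, by simp [h.1]⟩
  · obtain ⟨z, w, c, hzw, hc⟩ := segre_exchange (fun e => hij (by rw [e])) h.2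
    exact ⟨(true, z), (true, w), (a₀, c), by simp [hzw], by simp [hc, add_assoc]⟩

/-- The congruence on `segre I × segre I` that identifies `(x + x̄, 0)` with `(0, x + x̄)`. -/
def PairRel (p q : segre I × segre I) : Prop :=
  ∃ i j : ℕ, p + (i • segPair I, j • segPair I) = q + (j • segPair I, i • segPair I)

theorem PairRel.refl (p : segre I × segre I) : PairRel p p := ⟨0, 0, rfl⟩

theorem PairRel.of_eq {p q : segre I × segre I} (h : p = q) : PairRel p q := h ▸ .refl p

theorem PairRel.swap {p q : segre I × segre I} (h : PairRel p q) : PairRel p.swap q.swap := by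
  obtain ⟨i, j, h⟩ := h
  exact ⟨j, i, by simpa using congrArg Prod.swap h⟩

/-- Cancelling min(i, j) leaves copies of `segPair` moving in one direction only. -/
theorem pairRel_cases {p q : segre I × segre I} (h : PairRel p q) :
    (∃ j : ℕ, p.1 + j • segPair I = q.1 ∧ p.2 = q.2 + j • segPair I) ∨
      ∃ j : ℕ, p.1 = q.1 + j • segPair I ∧ p.2 + j • segPair I = q.2 := by
  obtain ⟨i, j, h⟩ := h
  obtain ⟨h₁, h₂⟩ := Prod.ext_iff.mp h
  simp only [Prod.fst_add, Prod.snd_add] at h₁ h₂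
  rcases le_total i j with hij | hij
  · obtain ⟨t, rfl⟩ := Nat.exists_eq_add_of_le hij
    right
    refine ⟨t, add_right_cancel (b := i • segPair I) ?_, add_right_cancel (b := i • segPair I) ?_⟩
    · rw [h₁, add_smul]; abel
    · rw [← h₂, add_smul]; abel
  · obtain ⟨t, rfl⟩ := Nat.exists_eq_add_of_le hij
    left
    refine ⟨t, add_right_cancel (b := j • segPair I) ?_, add_right_cancel (b := j • segPair I) ?_⟩
    · rw [← h₁, add_smul]; abel
    · rw [h₂, add_smul]; abel

theorem pairRel_exchange_same {x y : I → Bool} (hxy : x ≠ y) {a b : segre I × segre I}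
    (h : PairRel (pairGen (false, x) + a) (pairGen (false, y) + b)) :
    ∃ z w c, segGen x + segGen z = segGen y + segGen w ∧
      PairRel (pairGen (false, x) + a) (pairGen (false, x) + pairGen (false, z) + c) := by
  obtain ⟨a₀, a₁⟩ := a
  obtain ⟨b₀, b₁⟩ := b
  rcases pairRel_cases h with ⟨j, h₀, h₁⟩ | ⟨j, h₀, h₁⟩ <;>
    simp only [pairGen_false, Prod.mk_add_mk, zero_add] at h₀ h₁
  · rw [add_assoc] at h₀
    -- The exchange is made after moving the j pairs from the second component to the first.
    obtain ⟨z, w, c, hzw, hc⟩ := segre_exchange hxy h₀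
    refine ⟨z, w, (c, b₁), hzw, j, 0, ?_⟩
    simp [h₁, add_assoc, hc]
  · rw [add_assoc] at h₀
    obtain ⟨z, w, c, hzw, hc⟩ := segre_exchange hxy h₀
    exact ⟨z, w, (c, a₁), hzw, .of_eq (by simp [hc, add_assoc])⟩

theorem pairRel_exchange_mixed {x y : I → Bool} {a b : segre I × segre I}
    (h : PairRel (pairGen (false, x) + a) (pairGen (true, y) + b)) :
    ∃ p q c, PairRel (pairGen (false, x) + pairGen p) (pairGen (true, y) + pairGen q) ∧
      PairRel (pairGen (false, x) + a) (pairGen (false, x) + pairGen p + c) := by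
  obtain ⟨a₀, a₁⟩ := a
  obtain ⟨b₀, b₁⟩ := b
  rcases pairRel_cases h with ⟨j, h₀, h₁⟩ | ⟨j, h₀, h₁⟩ <;>
    simp only [pairGen_false, pairGen_true, Prod.mk_add_mk, zero_add] at h₀ h₁
  · exact ⟨(true, y), (false, x), (a₀, b₁ + j • segPair I), .of_eq (by simp),
      .of_eq (by simp [h₁, add_assoc])⟩
  · cases j with
    | zero =>
      rw [zero_smul, add_zero] at h₁
      exact ⟨(true, y), (false, x), (a₀, b₁), .of_eq (by simp), .of_eq (by simp [h₁])⟩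
    | succ j =>
      -- Here y need not divide the second component, but the first contains a pair: it is written
      -- as x + x̄ and identified with y + ȳ in the other copy.
      refine ⟨(false, fun i => !x i), (true, fun i => !y i), (b₀ + j • segPair I, a₁),
        ⟨0, 1, ?_⟩, .of_eq ?_⟩
      · simp [segGen_add_segGen_not]
      · simp only [pairGen_false, Prod.mk_add_mk, zero_add, add_zero, segGen_add_segGen_not, h₀,
          succ_nsmul, Prod.mk.injEq, and_true]
        abel

theorem swap_pairGen (p : Bool × (I → Bool)) : (pairGen p).swap = pairGen (!p.1, p.2) := by
  obtain ⟨β, x⟩ := p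
  cases β <;> rfl

theorem pairRel_exchange {i j : Bool × (I → Bool)} (hij : i ≠ j) {a b : segre I × segre I}
    (h : PairRel (pairGen i + a) (pairGen j + b)) :
    ∃ p q c, PairRel (pairGen i + pairGen p) (pairGen j + pairGen q) ∧
      PairRel (pairGen i + a) (pairGen i + pairGen p + c) := by
  obtain ⟨β, x⟩ := i
  obtain ⟨γ, y⟩ := j
  cases β <;> cases γ
  · obtain ⟨z, w, c, hzw, hc⟩ := pairRel_exchange_same (fun e => hij (by rw [e])) h
    exact ⟨(false, z), (false, w), c, .of_eq (by simp [hzw]), hc⟩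
  · exact pairRel_exchange_mixed h
  · obtain ⟨p, q, c, h₁, h₂⟩ := pairRel_exchange_mixed (x := x) (y := y) (a := a.swap)
      (b := b.swap) (by simpa [swap_pairGen, -pairGen_true, -pairGen_false] using h.swap)
    refine ⟨(!p.1, p.2), (!q.1, q.2), c.swap, ?_, ?_⟩
    · simpa [swap_pairGen, -pairGen_true, -pairGen_false] using h₁.swap
    · simpa [swap_pairGen, -pairGen_true, -pairGen_false] using h₂.swap
  · obtain ⟨z, w, c, hzw, h₂⟩ := pairRel_exchange_same (x := x) (y := y) (a := a.swap)
      (b := b.swap) (fun e => hij (by rw [e]))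
      (by simpa [swap_pairGen, -pairGen_true, -pairGen_false] using h.swap)
    refine ⟨(true, z), (true, w), c.swap, .of_eq (by simp [hzw]), ?_⟩
    simpa [swap_pairGen, -pairGen_true, -pairGen_false] using h₂.swap

end Double

section Cuts

variable {V : Type*}

/-- The vertices with bit `true`. -/
def bitSet (b : V → Bool) : Set V := {v | b v = true}

theorem separates_bitSet (b : V → Bool) (v w : V) :
    Separates (bitSet b) s(v, w) ↔ b v ≠ b w := by
  constructor
  · rintro ⟨i, hi, j, hj, h⟩
    simp only [bitSet, Set.mem_ofPred_eq] at hi hj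
    rcases Sym2.eq_iff.mp h with ⟨rfl, rfl⟩ | ⟨rfl, rfl⟩ <;> simp_all
  · intro h
    cases hv : b v <;> cases hw : b w
    · simp_all
    · exact ⟨w, hw, v, by simp [bitSet, hv], Sym2.eq_swap⟩
    · exact ⟨v, hv, w, by simp [bitSet, hw], rfl⟩
    · simp_all

open Classical in
theorem ite_separates_bitSet (b : V → Bool) (v w : V) :
    (if Separates (bitSet b) s(v, w) then 1 else 0) = if b v ≠ b w then 1 else 0 := by
  simp only [separates_bitSet]

open Classical in
theorem Cut.exists_eq_mk_bitSet (v : V) (c : Cut V) :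
    ∃ b : V → Bool, b v = false ∧ Cut.mk (bitSet b) = c := by
  obtain ⟨B, rfl⟩ := Quotient.exists_rep c
  have hB : ∀ B : Set V, v ∉ B → ∃ b : V → Bool, b v = false ∧ Cut.mk (bitSet b) = Cut.mk B :=
    fun B h => ⟨fun w => decide (w ∈ B), by simpa using h, by simp [bitSet]⟩
  by_cases h : v ∈ B
  · obtain ⟨b, hb, hb'⟩ := hB Bᶜ (fun h' => h' h)
    exact ⟨b, hb, hb'.trans (Cut.mk_compl B)⟩
  · exact hB B h

end Cuts

section Star

variable {m : ℕ}

/-- Bits on the star: `false` at the centre, `x` at the leaves. -/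
def starBits (x : Fin m → Bool) : (Σ i : Fin 2, Fin (![1, m] i)) → Bool
  | ⟨0, _⟩ => false
  | ⟨1, i⟩ => x i

theorem surjective_mk_starBits :
    Function.Surjective fun x : Fin m → Bool => Cut.mk (bitSet (starBits x)) := by
  intro c
  obtain ⟨b, hb, rfl⟩ := Cut.exists_eq_mk_bitSet ⟨0, (0 : Fin 1)⟩ c
  refine ⟨fun i => b ⟨1, i⟩, ?_⟩
  dsimp only
  congr 2
  funext v
  obtain ⟨k, i⟩ := v
  fin_cases k
  · change Fin 1 at i
    obtain rfl := Subsingleton.elim i 0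
    exact hb.symm
  · rfl

/-- The edge of the star at the leaf `i`. -/
def starEdge (i : Fin m) : (completeMultipartite ![1, m]).edgeSet :=
  ⟨s(⟨0, (0 : Fin 1)⟩, ⟨1, i⟩), show (0 : Fin 2) ≠ 1 by decide⟩

theorem exists_eq_starEdge (e : (completeMultipartite ![1, m]).edgeSet) :
    ∃ i : Fin m, e = starEdge i := by
  obtain ⟨e, he⟩ := e
  induction e using Sym2.ind with
  | _ v w =>
  obtain ⟨k, i⟩ := v
  obtain ⟨l, j⟩ := w
  have hkl : k ≠ l := he
  fin_cases k <;> fin_cases l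
  · exact absurd rfl hkl
  · change Fin 1 at i
    obtain rfl := Subsingleton.elim i 0
    exact ⟨j, rfl⟩
  · change Fin 1 at j
    obtain rfl := Subsingleton.elim j 0
    exact ⟨i, Subtype.ext Sym2.eq_swap⟩
  · exact absurd rfl hkl

open Classical in
theorem segOne_eq_separates_starEdge (i : Fin m) (x : Fin m → Bool) :
    segOne i (segGen x) = if Separates (bitSet (starBits x)) (starEdge i).1 then 1 else 0 := by
  rw [starEdge, ite_separates_bitSet]
  change (if x i then 1 else 0) = if false ≠ x i then 1 else 0
  cases x i <;> simp

theorem exists_starExponentHom (m : ℕ) :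
    ∃ ℓ : segre (Fin m) →+ (Option (completeMultipartite ![1, m]).edgeSet →₀ ℕ),
      (∀ x, ℓ (segGen x) = cutExponent _ (bitSet (starBits x))) ∧ Function.Injective ℓ := by
  classical
  obtain ⟨ℓ, hℓ⟩ := exists_exponentHom (completeMultipartite ![1, m]) segGen
    (fun x => bitSet (starBits x)) segDeg segDeg_segGen fun e he => by
      obtain ⟨i, hi⟩ := exists_eq_starEdge ⟨e, he⟩
      obtain rfl : e = (starEdge i).1 := congrArg Subtype.val hi
      exact ⟨segOne i, segOne_eq_separates_starEdge i⟩
  refine ⟨ℓ, hℓ, fun p q h => segre_ext ?_ fun i => ?_⟩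
  · rw [← exponentHom_apply_none _ closure_range_segGen hℓ segDeg segDeg_segGen, h,
      exponentHom_apply_none _ closure_range_segGen hℓ segDeg segDeg_segGen]
  · rw [← exponentHom_apply_some _ closure_range_segGen hℓ (starEdge i) (segOne i)
        (segOne_eq_separates_starEdge i), h,
      exponentHom_apply_some _ closure_range_segGen hℓ (starEdge i) (segOne i)
        (segOne_eq_separates_starEdge i)]

end Star

section PairForms

variable {I : Type*}

/-- The additive map on `segre I × segre I` given by its two components. -/
def pairForm (f g : segre I →+ ℕ) : segre I × segre I →+ ℕ := f.coprod g

@[simp] theorem pairForm_apply (f g : segre I →+ ℕ) (q : segre I × segre I) :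
    pairForm f g q = f q.1 + g q.2 := rfl

theorem pairForm_segDeg_pairGen (p : Bool × (I → Bool)) :
    pairForm segDeg segDeg (pairGen p) = 1 := by
  obtain ⟨β, x⟩ := p
  cases β <;> simp

theorem pairForm_zero_segDeg_pairGen (p : Bool × (I → Bool)) :
    pairForm 0 segDeg (pairGen p) = if false ≠ p.1 then 1 else 0 := by
  obtain ⟨β, x⟩ := p
  cases β <;> simp

theorem pairForm_segOne_segOne_pairGen (i : I) (p : Bool × (I → Bool)) :
    pairForm (segOne i) (segOne i) (pairGen p) = if false ≠ p.2 i then 1 else 0 := by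
  obtain ⟨β, x⟩ := p
  cases β <;> cases h : x i <;> simp [h]

theorem pairForm_segOne_segZero_pairGen (i : I) (p : Bool × (I → Bool)) :
    pairForm (segOne i) (segZero i) (pairGen p) = if p.1 ≠ p.2 i then 1 else 0 := by
  obtain ⟨β, x⟩ := p
  cases β <;> cases h : x i <;> simp [h]

end PairForms

section TriPartite

variable {m : ℕ}

/-- Bits on `K_{1,1,m}`: `false` and `p.1` at the two singleton parts, `p.2` on the third part. -/
def triBits (p : Bool × (Fin m → Bool)) : (Σ i : Fin 3, Fin (![1, 1, m] i)) → Bool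
  | ⟨0, _⟩ => false
  | ⟨1, _⟩ => p.1
  | ⟨2, i⟩ => p.2 i

theorem surjective_mk_triBits :
    Function.Surjective fun p : Bool × (Fin m → Bool) => Cut.mk (bitSet (triBits p)) := by
  intro c
  obtain ⟨b, hb, rfl⟩ := Cut.exists_eq_mk_bitSet ⟨0, (0 : Fin 1)⟩ c
  refine ⟨(b ⟨1, (0 : Fin 1)⟩, fun i => b ⟨2, i⟩), ?_⟩
  dsimp only
  congr 2
  funext v
  obtain ⟨k, i⟩ := v
  fin_cases k
  · change Fin 1 at i
    obtain rfl := Subsingleton.elim i 0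
    exact hb.symm
  · change Fin 1 at i
    obtain rfl := Subsingleton.elim i 0
    rfl
  · rfl

/-- The edge between the two singleton parts. -/
def triBase (m : ℕ) : (completeMultipartite ![1, 1, m]).edgeSet :=
  ⟨s(⟨0, (0 : Fin 1)⟩, ⟨1, (0 : Fin 1)⟩), show (0 : Fin 3) ≠ 1 by decide⟩

/-- The edges at the first singleton part. -/
def triLeft (i : Fin m) : (completeMultipartite ![1, 1, m]).edgeSet :=
  ⟨s(⟨0, (0 : Fin 1)⟩, ⟨2, i⟩), show (0 : Fin 3) ≠ 2 by decide⟩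

/-- The edges at the second singleton part. -/
def triRight (i : Fin m) : (completeMultipartite ![1, 1, m]).edgeSet :=
  ⟨s(⟨1, (0 : Fin 1)⟩, ⟨2, i⟩), show (1 : Fin 3) ≠ 2 by decide⟩

theorem tri_edge_cases (e : (completeMultipartite ![1, 1, m]).edgeSet) :
    e = triBase m ∨ (∃ i, e = triLeft i) ∨ ∃ i, e = triRight i := by
  obtain ⟨e, he⟩ := e
  induction e using Sym2.ind with
  | _ v w =>
  obtain ⟨k, i⟩ := v
  obtain ⟨l, j⟩ := w
  have hkl : k ≠ l := he
  have h0 : ∀ i : Fin 1, i = 0 := fun i => Subsingleton.elim i 0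
  fin_cases k <;> fin_cases l
  · exact absurd rfl hkl
  · obtain rfl := h0 i
    obtain rfl := h0 j
    exact Or.inl rfl
  · obtain rfl := h0 i
    exact Or.inr (Or.inl ⟨j, rfl⟩)
  · obtain rfl := h0 i
    obtain rfl := h0 j
    exact Or.inl (Subtype.ext Sym2.eq_swap)
  · exact absurd rfl hkl
  · obtain rfl := h0 i
    exact Or.inr (Or.inr ⟨j, rfl⟩)
  · obtain rfl := h0 j
    exact Or.inr (Or.inl ⟨i, Subtype.ext Sym2.eq_swap⟩)
  · obtain rfl := h0 j
    exact Or.inr (Or.inr ⟨i, Subtype.ext Sym2.eq_swap⟩)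
  · exact absurd rfl hkl

open Classical in
theorem form_triBase (p : Bool × (Fin m → Bool)) :
    pairForm 0 segDeg (pairGen p) =
      if Separates (bitSet (triBits p)) (triBase m).1 then 1 else 0 := by
  rw [triBase, ite_separates_bitSet, pairForm_zero_segDeg_pairGen]
  rfl

open Classical in
theorem form_triLeft (i : Fin m) (p : Bool × (Fin m → Bool)) :
    pairForm (segOne i) (segOne i) (pairGen p) =
      if Separates (bitSet (triBits p)) (triLeft i).1 then 1 else 0 := by
  rw [triLeft, ite_separates_bitSet, pairForm_segOne_segOne_pairGen]
  rfl

open Classical in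
theorem form_triRight (i : Fin m) (p : Bool × (Fin m → Bool)) :
    pairForm (segOne i) (segZero i) (pairGen p) =
      if Separates (bitSet (triBits p)) (triRight i).1 then 1 else 0 := by
  rw [triRight, ite_separates_bitSet, pairForm_segOne_segZero_pairGen]
  rfl

theorem exists_triExponentHom (m : ℕ) :
    ∃ ℓ : segre (Fin m) × segre (Fin m) →+
        (Option (completeMultipartite ![1, 1, m]).edgeSet →₀ ℕ),
      (∀ p, ℓ (pairGen p) = cutExponent _ (bitSet (triBits p))) ∧ Function.Injective ℓ := by
  classical
  obtain ⟨ℓ, hℓ⟩ := exists_exponentHom (completeMultipartite ![1, 1, m]) pairGen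
    (fun p => bitSet (triBits p)) (pairForm segDeg segDeg) pairForm_segDeg_pairGen
    fun e he => by
      rcases tri_edge_cases ⟨e, he⟩ with h | ⟨i, h⟩ | ⟨i, h⟩
      · obtain rfl : e = (triBase m).1 := congrArg Subtype.val h
        exact ⟨_, form_triBase⟩
      · obtain rfl : e = (triLeft i).1 := congrArg Subtype.val h
        exact ⟨_, form_triLeft i⟩
      · obtain rfl : e = (triRight i).1 := congrArg Subtype.val h
        exact ⟨_, form_triRight i⟩
  refine ⟨ℓ, hℓ, fun p q h => ?_⟩
  have hdeg : pairForm segDeg segDeg p = pairForm segDeg segDeg q := by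
    rw [← exponentHom_apply_none _ closure_range_pairGen hℓ _ pairForm_segDeg_pairGen, h,
      exponentHom_apply_none _ closure_range_pairGen hℓ _ pairForm_segDeg_pairGen]
  have hbase : pairForm 0 segDeg p = pairForm 0 segDeg q := by
    rw [← exponentHom_apply_some _ closure_range_pairGen hℓ _ _ form_triBase, h,
      exponentHom_apply_some _ closure_range_pairGen hℓ _ _ form_triBase]
  have hleft : ∀ i, pairForm (segOne i) (segOne i) p = pairForm (segOne i) (segOne i) q :=
    fun i => by
      rw [← exponentHom_apply_some _ closure_range_pairGen hℓ _ _ (form_triLeft i), h,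
        exponentHom_apply_some _ closure_range_pairGen hℓ _ _ (form_triLeft i)]
  have hright : ∀ i, pairForm (segOne i) (segZero i) p = pairForm (segOne i) (segZero i) q :=
    fun i => by
      rw [← exponentHom_apply_some _ closure_range_pairGen hℓ _ _ (form_triRight i), h,
        exponentHom_apply_some _ closure_range_pairGen hℓ _ _ (form_triRight i)]
  simp only [pairForm_apply, AddMonoidHom.zero_apply, zero_add] at hdeg hbase hleft hright
  refine Prod.ext (segre_ext (by omega) fun i => ?_) (segre_ext hbase fun i => ?_) <;>
  · have := hleft i
    have := hright i
    have := segOne_add_segZero i p.2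
    have := segOne_add_segZero i q.2
    omega

end TriPartite

section BiPartite

variable {m : ℕ}

/-- Bits on `K_{2,m}`: `false` and `p.1` on the first part, `p.2` on the second part. -/
def biBits (p : Bool × (Fin m → Bool)) : (Σ i : Fin 2, Fin (![2, m] i)) → Bool
  | ⟨0, j⟩ => if (show Fin 2 from j) = 0 then false else p.1
  | ⟨1, i⟩ => p.2 i

theorem surjective_mk_biBits :
    Function.Surjective fun p : Bool × (Fin m → Bool) => Cut.mk (bitSet (biBits p)) := by
  intro c
  obtain ⟨b, hb, rfl⟩ := Cut.exists_eq_mk_bitSet ⟨0, (0 : Fin 2)⟩ c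
  refine ⟨(b ⟨0, (1 : Fin 2)⟩, fun i => b ⟨1, i⟩), ?_⟩
  dsimp only
  congr 2
  funext v
  obtain ⟨k, i⟩ := v
  fin_cases k
  · change Fin 2 at i
    fin_cases i
    · exact hb.symm
    · rfl
  · rfl

/-- The edges of `K_{2,m}`. -/
def biEdge (j : Fin 2) (i : Fin m) : (completeMultipartite ![2, m]).edgeSet :=
  ⟨s(⟨0, j⟩, ⟨1, i⟩), show (0 : Fin 2) ≠ 1 by decide⟩

theorem exists_eq_biEdge (e : (completeMultipartite ![2, m]).edgeSet) :
    ∃ j i, e = biEdge j i := by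
  obtain ⟨e, he⟩ := e
  induction e using Sym2.ind with
  | _ v w =>
  obtain ⟨k, i⟩ := v
  obtain ⟨l, j⟩ := w
  have hkl : k ≠ l := he
  fin_cases k <;> fin_cases l
  · exact absurd rfl hkl
  · exact ⟨i, j, rfl⟩
  · exact ⟨j, i, Subtype.ext Sym2.eq_swap⟩
  · exact absurd rfl hkl

/-- The form on `segre × segre` that computes the exponent at `biEdge j i`. -/
def biForm (j : Fin 2) (i : Fin m) : segre (Fin m) × segre (Fin m) →+ ℕ :=
  if j = 0 then pairForm (segOne i) (segOne i) else pairForm (segOne i) (segZero i)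

open Classical in
theorem biForm_pairGen (j : Fin 2) (i : Fin m) (p : Bool × (Fin m → Bool)) :
    biForm j i (pairGen p) =
      if Separates (bitSet (biBits p)) (biEdge j i).1 then 1 else 0 := by
  rw [biEdge, ite_separates_bitSet]
  fin_cases j
  · exact pairForm_segOne_segOne_pairGen i p
  · exact pairForm_segOne_segZero_pairGen i p

theorem exists_biExponentHom (hm : 0 < m) :
    ∃ ℓ : segre (Fin m) × segre (Fin m) →+ (Option (completeMultipartite ![2, m]).edgeSet →₀ ℕ),
      (∀ p, ℓ (pairGen p) = cutExponent _ (bitSet (biBits p))) ∧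
        ∀ p q, ℓ p = ℓ q ↔ PairRel p q := by
  classical
  obtain ⟨ℓ, hℓ⟩ := exists_exponentHom (completeMultipartite ![2, m]) pairGen
    (fun p => bitSet (biBits p)) (pairForm segDeg segDeg) pairForm_segDeg_pairGen
    fun e he => by
      obtain ⟨j, i, h⟩ := exists_eq_biEdge ⟨e, he⟩
      obtain rfl : e = (biEdge j i).1 := congrArg Subtype.val h
      exact ⟨_, biForm_pairGen j i⟩
  have hnone : ∀ q, ℓ q none = segDeg q.1 + segDeg q.2 :=
    exponentHom_apply_none _ closure_range_pairGen hℓ _ pairForm_segDeg_pairGen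
  have hsome : ∀ j i q, ℓ q (some (biEdge j i)) = biForm j i q := fun j i =>
    exponentHom_apply_some _ closure_range_pairGen hℓ _ _ (biForm_pairGen j i)
  refine ⟨ℓ, hℓ, fun p q => ⟨fun h => ?_, ?_⟩⟩
  · have hdeg : segDeg p.1 + segDeg p.2 = segDeg q.1 + segDeg q.2 := by
      rw [← hnone, h, hnone]
    have hleft : ∀ i, segOne i p.1 + segOne i p.2 = segOne i q.1 + segOne i q.2 := fun i =>
      (hsome 0 i p).symm.trans ((by rw [h] : _ = _).trans (hsome 0 i q))
    have hright : ∀ i, segOne i p.1 + segZero i p.2 = segOne i q.1 + segZero i q.2 := fun i =>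
      (hsome 1 i p).symm.trans ((by rw [h] : _ = _).trans (hsome 1 i q))
    have key : ∀ i, 2 * segOne i p.1 + segDeg p.2 = 2 * segOne i q.1 + segDeg q.2 := fun i => by
      have := hleft i
      have := hright i
      have := segOne_add_segZero i p.2
      have := segOne_add_segZero i q.2
      omega
    refine ⟨segOne ⟨0, hm⟩ q.1, segOne ⟨0, hm⟩ p.1, ?_⟩
    have k0 := key ⟨0, hm⟩
    refine Prod.ext (segre_ext ?_ fun i => ?_) (segre_ext ?_ fun i => ?_) <;>
      simp only [Prod.fst_add, Prod.snd_add, map_add, map_nsmul, segDeg_segPair, segOne_segPair,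
        smul_eq_mul]
    · omega
    · have := key i
      omega
    · omega
    · have := key i
      have := hleft i
      omega
  · rintro ⟨i, j, h⟩
    have hpair : ℓ (segPair _, 0) = ℓ (0, segPair _) := by
      ext o
      cases o with
      | none => simp [hnone]
      | some e =>
        obtain ⟨j, i, rfl⟩ := exists_eq_biEdge e
        rw [hsome, hsome]
        fin_cases j <;> simp [biForm]
    have hsplit : ∀ i j : ℕ, ℓ (i • segPair (Fin m), j • segPair (Fin m)) =
        i • ℓ (segPair _, 0) + j • ℓ (segPair _, 0) := fun i j => by
      nth_rewrite 2 [hpair]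
      rw [← map_nsmul, ← map_nsmul, ← map_add]
      simp
    have := congrArg ℓ h
    rw [map_add, map_add, hsplit, hsplit, add_comm (j • _)] at this
    exact add_right_cancel this

end BiPartite

section Main

variable (K : Type*) [Field K] (m : ℕ)

theorem isStronglyKoszul_tripartite :
    IsStronglyKoszul K (cutGen K (completeMultipartite ![1, 1, m])) := by
  obtain ⟨ℓ, hℓ, hinj⟩ := exists_triExponentHom m
  refine isStronglyKoszul_cutGen K closure_range_pairGen surjective_mk_triBits hℓ ?_
  intro i j hij a b h
  obtain ⟨p, q, c, h₁, h₂⟩ := pairGen_exchange hij (hinj h)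
  exact ⟨p, q, c, congrArg ℓ h₁, congrArg ℓ h₂⟩

theorem isStronglyKoszul_bipartite (hm : 0 < m) :
    IsStronglyKoszul K (cutGen K (completeMultipartite ![2, m])) := by
  obtain ⟨ℓ, hℓ, hrel⟩ := exists_biExponentHom hm
  refine isStronglyKoszul_cutGen K closure_range_pairGen surjective_mk_biBits hℓ ?_
  simp only [hrel]
  intro i j hij a b h
  exact pairRel_exchange hij h

theorem exists_tripartite_equiv_tensor :
    ∃ φ : cutRing K (completeMultipartite ![1, 1, m]) ≃ₐ[K]
        cutRing K (completeMultipartite ![1, m]) ⊗[K] cutRing K (completeMultipartite ![1, m]),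
      φ '' Set.range (cutGen K (completeMultipartite ![1, 1, m])) =
        (Set.range fun c => cutGen K (completeMultipartite ![1, m]) c ⊗ₜ[K]
            (1 : cutRing K (completeMultipartite ![1, m]))) ∪
          Set.range fun c => (1 : cutRing K (completeMultipartite ![1, m])) ⊗ₜ[K]
            cutGen K (completeMultipartite ![1, m]) c := by
  obtain ⟨ℓ, hℓ, hinj⟩ := exists_triExponentHom m
  obtain ⟨ℓ', hℓ', hinj'⟩ := exists_starExponentHom m
  have hR := range_toricHom_eq_cutRing K closure_range_pairGen surjective_mk_triBits hℓ
  have hR' := range_toricHom_eq_cutRing K closure_range_segGen surjective_mk_starBits hℓ'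
  let e := toricEquiv K hinj' hR'
  let φ := (toricEquiv K hinj hR).symm.trans
    ((prodTensorEquiv K (Q := segre (Fin m)) (segre (Fin m))).symm.trans (Algebra.TensorProduct.congr e e))
  have hφ : ∀ p, φ (cutGen K _ (Cut.mk (bitSet (triBits p)))) =
      e (AddMonoidAlgebra.single (pairGen p).1 1) ⊗ₜ[K]
        e (AddMonoidAlgebra.single (pairGen p).2 1) := by
    intro p
    rw [← toricEquiv_single K hinj hR hℓ p]
    simp only [φ, AlgEquiv.trans_apply, AlgEquiv.symm_apply_apply]
    rw [← Prod.mk.eta (p := pairGen p), prodTensorEquiv_symm_single]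
    rfl
  have hgen : ∀ x, e (AddMonoidAlgebra.single (segGen x) 1) =
      cutGen K _ (Cut.mk (bitSet (starBits x))) := toricEquiv_single K hinj' hR' hℓ'
  have hone : e (AddMonoidAlgebra.single 0 1) = 1 := map_one e
  refine ⟨φ, Set.Subset.antisymm ?_ (Set.union_subset ?_ ?_)⟩
  · rintro _ ⟨_, ⟨c, rfl⟩, rfl⟩
    obtain ⟨⟨β, x⟩, rfl⟩ := surjective_mk_triBits c
    dsimp only
    rw [hφ]
    cases β
    · exact Or.inl ⟨Cut.mk (bitSet (starBits x)), by simp only [pairGen_false, hgen, hone]⟩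
    · exact Or.inr ⟨Cut.mk (bitSet (starBits x)), by simp only [pairGen_true, hgen, hone]⟩
  · rintro _ ⟨c, rfl⟩
    obtain ⟨x, rfl⟩ := surjective_mk_starBits c
    exact ⟨_, ⟨Cut.mk (bitSet (triBits (false, x))), rfl⟩, by
      simp only [hφ, pairGen_false, hgen, hone]⟩
  · rintro _ ⟨c, rfl⟩
    obtain ⟨x, rfl⟩ := surjective_mk_starBits c
    exact ⟨_, ⟨Cut.mk (bitSet (triBits (true, x))), rfl⟩, by
      simp only [hφ, pairGen_true, hgen, hone]⟩

end Main

end CutToric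

end

theorem mainTheorem4 (K : Type*) [Field K] (n : ℕ) (hn : 4 ≤ n) :
    CutToric.IsStronglyKoszul K
        (CutToric.cutGen K (CutToric.completeMultipartite ![1, 1, n - 2])) ∧
      CutToric.IsStronglyKoszul K
        (CutToric.cutGen K (CutToric.completeMultipartite ![2, n - 2])) ∧
      -- an isomorphism of `K`-algebras that matches the semigroup generators, hence the gradings
      ∃ φ : CutToric.cutRing K (CutToric.completeMultipartite ![1, 1, n - 2]) ≃ₐ[K]
          CutToric.cutRing K (CutToric.completeMultipartite ![1, n - 2]) ⊗[K]
            CutToric.cutRing K (CutToric.completeMultipartite ![1, n - 2]),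
        φ '' Set.range (CutToric.cutGen K (CutToric.completeMultipartite ![1, 1, n - 2])) =
          (Set.range fun c =>
              CutToric.cutGen K (CutToric.completeMultipartite ![1, n - 2]) c ⊗ₜ[K]
                (1 : CutToric.cutRing K (CutToric.completeMultipartite ![1, n - 2]))) ∪
            Set.range fun c =>
              (1 : CutToric.cutRing K (CutToric.completeMultipartite ![1, n - 2])) ⊗ₜ[K]
                CutToric.cutGen K (CutToric.completeMultipartite ![1, n - 2]) c := by
  exact ⟨CutToric.isStronglyKoszul_tripartite K (n - 2),
    CutToric.isStronglyKoszul_bipartite K (n - 2) (by omega),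
    CutToric.exists_tripartite_equiv_tensor K (n - 2)⟩
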